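/- Let $G=(V,E)$ be a finite simple undirected graph with $n=|V|\ge 1$ vertices and maximum degree $\Delta$. For a nonempty $S\subseteq V$ let $\rho(S)=|E(S)|/|S|$, where $E(S)$ is the set of edges of $G$ with both endpoints in $S$, and let $\rho^*=\max_{\emptyset\ne S\subseteq V}\rho(S)$. The algorithm GreedySorting++ with $T$ iterations works as follows. Initially $\ell(v)=0$ for all $v\in V$, and $S=V$. Each of the $T$ iterations sorts the vertices as $v_1,\dots,v_n$ so that $\ell(v_1)\le\dots\le\ell(v_n)$ for the loads at the beginning of the iteration (ties broken arbitrarily), sets $H=V$, and then for $j=1,\dots,n$ in turn: (i) if $\rho(H)>\rho(S)$, it sets $S\leftarrow H$; (ii) it increases $\ell(v_j)$ by the number of neighbours of $v_j$ in $H$; (iii) it removes $v_j$ from $H$. After the last iteration it outputs $S$. Theorem. For $T=\Theta\!\left(\frac{\Delta\log n}{\rho^*\varepsilon^2}\right)$, GreedySorting++ outputs a $(1+\varepsilon)$-approximate densest subgraph. Precisely: there is an absolute constant $C>0$ such that for every such $G$, every $0<\varepsilon<1$, and every integer $T\ge 0$ with $T\rho^*\varepsilon^2\ge C\,\Delta\log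 n$ (that is, $T\ge C\,\frac{\Delta\log n}{\rho^*\varepsilon^2}$ if $G$ has an edge, and any $T\ge 0$ otherwise), the set $S$ output by $T$ iterations of GreedySorting++, however ties are broken, is nonempty and satisfies $\rho^*\le(1+\varepsilon)\,\rho(S)$. -/

import Mathlib

namespace DensestSubgraph

variable {V : Type*} [Fintype V] [DecidableEq V] (G : SimpleGraph V) [DecidableRel G.Adj]

/-- The edges of the subgraph of `G` induced by the vertex set `S`. -/
def inducedEdges (S : Finset V) : Finset (Sym2 V) :=
  G.edgeFinset.filter (fun e => ∀ v ∈ e, v ∈ S)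

/-- The density `|E(S)| / |S|` of the subgraph of `G` induced by `S` (used for nonempty `S`;
for `S = ∅` the value is `0`). -/
def density (S : Finset V) : ℚ :=
  ((inducedEdges G S).card : ℚ) / (S.card : ℚ)

/-- The maximum density `ρ*` of the subgraphs of `G` induced by nonempty vertex sets. -/
def maxDensity [Nonempty V] : ℚ :=
  (Finset.univ.filter (fun S : Finset V => S.Nonempty)).sup'
    ⟨Finset.univ, by simp⟩ (density G)

/-- `S` induces a `(1 + ε)`-approximate densest subgraph of `G`. -/
def IsApproxDensest [Nonempty V] (ε : ℝ) (S : Finset V) : Prop :=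
  S.Nonempty ∧ (maxDensity G : ℝ) ≤ (1 + ε) * (density G S : ℝ)

/-- The variables of the algorithm: the loads `ℓ`, the vertex set of the best subgraph found so
far, and the vertex set of the current (partially peeled) subgraph `H`. -/
structure State (V : Type*) where
  load : V → ℕ
  best : Finset V
  cur : Finset V

/-- Before the first iteration all loads are zero, and the best subgraph is `G` itself. -/
def initState (V : Type*) [Fintype V] : State V where
  load := fun _ => 0
  best := Finset.univ
  cur := Finset.univ

/-- One step of the inner loop: compare the current subgraph `H` with the best one, add to the
load of `v` its degree in `H`, and delete `v` from `H`. -/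
def peelStep (s : State V) (v : V) : State V where
  load := Function.update s.load v (s.load v + (G.neighborFinset v ∩ s.cur).card)
  best := if density G s.best < density G s.cur then s.cur else s.best
  cur := s.cur.erase v

/-- One iteration of the outer loop: starting from the full graph `H = G`, peel the vertices
in the given order. -/
def iteration (s : State V) (order : List V) : State V :=
  order.foldl (peelStep G) { s with cur := Finset.univ }

/-- `order` lists every vertex exactly once, by nondecreasing load. -/
def IsSortedByLoad (load : V → ℕ) (order : List V) : Prop :=
  order.Nodup ∧ (∀ v, v ∈ order) ∧ order.Pairwise (fun u v => load u ≤ load v)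

/-- `GreedySortingRun G T s`: some execution of `T` iterations of GreedySorting++ on `G` ends in
the state `s`. Every iteration peels the vertices in an order sorted by the loads at its
beginning; ties may be broken in any way, differently in every iteration. -/
inductive GreedySortingRun : ℕ → State V → Prop
  | init : GreedySortingRun 0 (initState V)
  | iter {t : ℕ} {s : State V} (order : List V) :
      GreedySortingRun t s → IsSortedByLoad s.load order →
      GreedySortingRun (t + 1) (iteration G s order)

end DensestSubgraph

/-!
The proof is a multiplicative-weights argument with weights `w v = exp (η * ℓ v)`, which order the
vertices in the same way as the loads `ℓ` do.

Within one iteration a vertex `v` gains the number `d v` of its neighbours that are peeled after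
it (`laterDegree`). Since the peeling order is sorted by `w`, Abel summation writes `∑ w v * d v`
as a nonnegative combination of the edge numbers of the suffixes `H` of the order. All these
suffixes are candidates for the output, so each has at most `ρ * |H|` edges, where `ρ` is the density
of the best set found; hence `∑ w v * d v ≤ ρ * ∑ w v` (`sum_mul_laterDegree_le`). As `d v ≤ Δ`, the
bound `exp x ≤ 1 + x + x ^ 2` for `0 ≤ x ≤ 1` turns this into a growth of the potential `∑ w v` by a
factor of at most `exp (η * (1 + η * Δ) * ρ)` per iteration (`sum_exp_mul_add_le`), so that after
`T` iterations the potential is at most `n * exp (T * η * (1 + η * Δ) * ρ)`.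

On the other hand each iteration distributes the edges of a vertex set `S` among the vertices of
`S`, so the loads on `S` add up to at least `T * |E(S)|`. For a densest `S` some load
is therefore at least `T * ρ*`, and comparing with the potential gives
`η * T * ρ* ≤ log n + T * η * (1 + η * Δ) * ρ` (`GreedySortingRun.mul_maxDensity_le`).
The choice `η = ε / (4 * Δ)` finishes the proof with the constant `C = 16`. No linear programming
duality is needed.
-/

namespace DensestSubgraph

variable {V : Type*} [Fintype V] [DecidableEq V] (G : SimpleGraph V) [DecidableRel G.Adj]

/-! ### Edge counts and densities -/

lemma card_inducedEdges_empty : (inducedEdges G ∅).card = 0 := by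
  rw [Finset.card_eq_zero, inducedEdges, Finset.filter_eq_empty_iff]
  intro e _ h
  induction e with
  | h a b => exact absurd (h a (Sym2.mem_mk_left a b)) (Finset.notMem_empty a)

lemma card_inducedEdges_insert {v : V} {S : Finset V} (hv : v ∉ S) :
    (inducedEdges G (insert v S)).card
      = (inducedEdges G S).card + (G.neighborFinset v ∩ S).card := by
  have hE : inducedEdges G (insert v S)
      = inducedEdges G S ∪ (G.neighborFinset v ∩ S).image (fun u => s(v, u)) := by
    ext e
    induction e with
    | h a b =>
      simp only [inducedEdges, Finset.mem_filter, SimpleGraph.mem_edgeFinset,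
        SimpleGraph.mem_edgeSet, Sym2.mem_iff, forall_eq_or_imp, forall_eq, Finset.mem_insert,
        Finset.mem_union, Finset.mem_image, Finset.mem_inter, SimpleGraph.mem_neighborFinset,
        Sym2.eq_iff]
      constructor
      · rintro ⟨hab, rfl | ha, rfl | hb⟩
        · exact absurd hab (G.irrefl)
        · exact Or.inr ⟨b, ⟨hab, hb⟩, Or.inl ⟨rfl, rfl⟩⟩
        · exact Or.inr ⟨a, ⟨hab.symm, ha⟩, Or.inr ⟨rfl, rfl⟩⟩
        · exact Or.inl ⟨hab, ha, hb⟩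
      · rintro (⟨hab, ha, hb⟩ | ⟨u, ⟨hvu, hu⟩, ⟨rfl, rfl⟩ | ⟨rfl, rfl⟩⟩)
        · exact ⟨hab, Or.inr ha, Or.inr hb⟩
        · exact ⟨hvu, Or.inl rfl, Or.inr hu⟩
        · exact ⟨hvu.symm, Or.inr hu, Or.inl rfl⟩
  rw [hE, Finset.card_union_of_disjoint, Finset.card_image_of_injective]
  · intro a b h
    exact Sym2.congr_right.1 h
  · rw [Finset.disjoint_left]
    intro e he he'
    obtain ⟨u, -, rfl⟩ := Finset.mem_image.1 he'
    exact hv ((Finset.mem_filter.1 he).2 v (Sym2.mem_mk_left v u))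

lemma density_nonneg (S : Finset V) : 0 ≤ density G S := by
  unfold density; positivity

lemma card_inducedEdges_eq (S : Finset V) :
    ((inducedEdges G S).card : ℝ) = (density G S : ℝ) * S.card := by
  rcases S.eq_empty_or_nonempty with rfl | hS
  · simp [card_inducedEdges_empty]
  · have : (S.card : ℝ) ≠ 0 := by exact_mod_cast hS.card_pos.ne'
    simp only [density]
    push_cast
    field_simp

lemma exists_density_eq_maxDensity [Nonempty V] :
    ∃ S : Finset V, S.Nonempty ∧ density G S = maxDensity G := by
  obtain ⟨S, hS, h⟩ := Finset.exists_mem_eq_sup'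
    (s := Finset.univ.filter (fun S : Finset V => S.Nonempty)) ⟨Finset.univ, by simp⟩ (density G)
  exact ⟨S, (Finset.mem_filter.1 hS).2, h.symm⟩

/-! ### One peeling pass -/

/-- The number of neighbours of a vertex that come after it in the list `l`, for `l` without
repetitions; `0` for vertices outside `l`. -/
def laterDegree : List V → V → ℕ
  | [] => fun _ => 0
  | v :: l => Function.update (laterDegree l) v (G.neighborFinset v ∩ l.toFinset).card

lemma laterDegree_cons_self (v : V) (l : List V) :
    laterDegree G (v :: l) v = (G.neighborFinset v ∩ l.toFinset).card := by
  simp [laterDegree]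

lemma laterDegree_cons_of_ne {u v : V} (h : u ≠ v) (l : List V) :
    laterDegree G (v :: l) u = laterDegree G l u := by
  simp [laterDegree, h]

lemma laterDegree_of_notMem {l : List V} {v : V} (h : v ∉ l) : laterDegree G l v = 0 := by
  induction l with
  | nil => rfl
  | cons a l ih =>
    rw [List.mem_cons, not_or] at h
    rw [laterDegree_cons_of_ne G h.1, ih h.2]

lemma laterDegree_le_maxDegree (l : List V) (v : V) : laterDegree G l v ≤ G.maxDegree := by
  induction l with
  | nil => exact Nat.zero_le _
  | cons a l ih =>
    by_cases h : v = a
    · subst h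
      rw [laterDegree_cons_self]
      exact (Finset.card_le_card Finset.inter_subset_left).trans (G.degree_le_maxDegree v)
    · rwa [laterDegree_cons_of_ne G h]

lemma sum_laterDegree_cons {M : Type*} [AddCommMonoid M] (f : V → ℕ → M) {v : V} {l : List V}
    (hv : v ∉ l) {S : Finset V} (hS : S ⊆ l.toFinset) :
    ∑ u ∈ insert v S, f u (laterDegree G (v :: l) u)
      = f v (G.neighborFinset v ∩ l.toFinset).card + ∑ u ∈ S, f u (laterDegree G l u) := by
  have hvS : v ∉ S := fun h => hv (List.mem_toFinset.1 (hS h))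
  rw [Finset.sum_insert hvS, laterDegree_cons_self]
  congr 1
  refine Finset.sum_congr rfl fun u hu => ?_
  rw [laterDegree_cons_of_ne G (ne_of_mem_of_not_mem hu hvS)]

/-- Every edge is counted at that endpoint which is peeled first. -/
lemma sum_laterDegree {l : List V} (hl : l.Nodup) :
    ∑ v ∈ l.toFinset, laterDegree G l v = (inducedEdges G l.toFinset).card := by
  induction l with
  | nil => simp [card_inducedEdges_empty]
  | cons v l ih =>
    rw [List.nodup_cons] at hl
    rw [List.toFinset_cons, sum_laterDegree_cons G (fun _ d => d) hl.1 subset_rfl, ih hl.2,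
      card_inducedEdges_insert G (by simpa using hl.1), add_comm]

lemma card_inducedEdges_le_sum_laterDegree {l : List V} (hl : l.Nodup) {S : Finset V}
    (hS : S ⊆ l.toFinset) :
    (inducedEdges G S).card ≤ ∑ v ∈ S, laterDegree G l v := by
  induction l generalizing S with
  | nil =>
    obtain rfl : S = ∅ := by simpa using hS
    simp [card_inducedEdges_empty]
  | cons v l ih =>
    rw [List.nodup_cons] at hl
    rw [List.toFinset_cons] at hS
    by_cases hv : v ∈ S
    · have hS' : S.erase v ⊆ l.toFinset := Finset.subset_insert_iff.1 hS
      rw [← Finset.insert_erase hv, sum_laterDegree_cons G (fun _ d => d) hl.1 hS',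
        card_inducedEdges_insert G (Finset.notMem_erase v S), add_comm]
      gcongr
      exact ih hl.2 hS'
    · have hS' : S ⊆ l.toFinset := (Finset.subset_insert_iff_of_notMem hv).1 hS
      refine (ih hl.2 hS').trans (Finset.sum_le_sum fun u hu => ?_)
      rw [laterDegree_cons_of_ne G (ne_of_mem_of_not_mem hu hv)]

/-- Abel summation along a list sorted by `w`, with edge numbers of all suffixes bounded by `ρ`
times their size. Subtracting a common lower bound `c` of the weights makes the induction on the
list work: passing to the tail, `c` is raised to the weight of the head. -/
lemma sum_sub_mul_laterDegree_le {l : List V} (hl : l.Nodup) {w : V → ℝ} {ρ c : ℝ}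
    (hw : l.Pairwise (fun u v => w u ≤ w v)) (hc : ∀ v ∈ l, c ≤ w v)
    (hρ : ∀ l', l' <:+ l → (density G l'.toFinset : ℝ) ≤ ρ) :
    ∑ v ∈ l.toFinset, (w v - c) * laterDegree G l v ≤ ρ * ∑ v ∈ l.toFinset, (w v - c) := by
  induction l generalizing c with
  | nil => simp
  | cons v l ih =>
    have hl' := List.nodup_cons.1 hl
    rw [List.pairwise_cons] at hw
    have hvl : v ∉ l.toFinset := by simpa using hl'.1
    have hv : c ≤ w v := hc v List.mem_cons_self
    have hrec := ih hl'.2 hw.2 hw.1 (fun l' h => hρ l' (h.trans (List.suffix_cons v l)))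
    have hE : ((∑ u ∈ (v :: l).toFinset, laterDegree G (v :: l) u : ℕ) : ℝ)
        ≤ ρ * (v :: l).toFinset.card := by
      rw [sum_laterDegree G hl, card_inducedEdges_eq]
      gcongr
      exact hρ _ List.suffix_rfl
    have hsplit : ∑ u ∈ (v :: l).toFinset, (w u - c) * (laterDegree G (v :: l) u : ℝ)
        = (w v - c) * ((∑ u ∈ (v :: l).toFinset, laterDegree G (v :: l) u : ℕ) : ℝ)
          + ∑ u ∈ l.toFinset, (w u - w v) * (laterDegree G l u : ℝ) := by
      have h0 := sum_laterDegree_cons G (fun u d => (w u - w v) * (d : ℝ)) hl'.1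
        (subset_refl l.toFinset)
      rw [sub_self, zero_mul, zero_add, ← List.toFinset_cons] at h0
      rw [← h0, Nat.cast_sum, Finset.mul_sum, ← Finset.sum_add_distrib]
      exact Finset.sum_congr rfl fun u _ => by ring
    have hsum : ∑ u ∈ (v :: l).toFinset, (w u - c)
        = (w v - c) * (v :: l).toFinset.card + ∑ u ∈ l.toFinset, (w u - w v) := by
      have h0 := Finset.sum_insert (f := fun u => w u - w v) hvl
      simp only [sub_self, zero_add] at h0
      rw [← h0, ← List.toFinset_cons, mul_comm, ← nsmul_eq_mul, ← Finset.sum_const,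
        ← Finset.sum_add_distrib]
      exact Finset.sum_congr rfl fun u _ => by ring
    rw [hsplit, hsum, mul_add]
    refine add_le_add ?_ hrec
    calc (w v - c) * ((∑ u ∈ (v :: l).toFinset, laterDegree G (v :: l) u : ℕ) : ℝ)
        ≤ (w v - c) * (ρ * (v :: l).toFinset.card) :=
          mul_le_mul_of_nonneg_left hE (sub_nonneg.2 hv)
      _ = ρ * ((w v - c) * (v :: l).toFinset.card) := by ring

/-- For nonnegative weights, peeling in sorted order spends at most `ρ` times the total weight. -/
lemma sum_mul_laterDegree_le {l : List V} (hl : l.Nodup) (hmem : ∀ v, v ∈ l) {w : V → ℝ} {ρ : ℝ}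
    (hw0 : ∀ v, 0 ≤ w v) (hw : l.Pairwise (fun u v => w u ≤ w v))
    (hρ : ∀ l', l' <:+ l → (density G l'.toFinset : ℝ) ≤ ρ) :
    ∑ v, w v * laterDegree G l v ≤ ρ * ∑ v, w v := by
  have huniv : l.toFinset = Finset.univ := by ext; simp [hmem]
  simpa [huniv] using sum_sub_mul_laterDegree_le G hl hw (fun v _ => hw0 v) hρ

/-- The effect of peeling `l` on the loads, when the current subgraph is the one induced by `l`. -/
lemma load_foldl_peelStep {l : List V} (hl : l.Nodup) {s : State V} (hs : s.cur = l.toFinset)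
    (v : V) : (l.foldl (peelStep G) s).load v = s.load v + laterDegree G l v := by
  induction l generalizing s with
  | nil => rfl
  | cons a l ih =>
    rw [List.nodup_cons] at hl
    have hal : a ∉ l.toFinset := by simpa using hl.1
    have hcur : (peelStep G s a).cur = l.toFinset := by
      simp [peelStep, hs, Finset.erase_insert hal]
    rw [List.foldl_cons, ih hl.2 hcur]
    by_cases h : v = a
    · subst h
      -- The algorithm still has `v` itself in the current subgraph, but `v` is not its neighbour.
      rw [laterDegree_of_notMem G hl.1, laterDegree_cons_self]
      simp [peelStep, hs, Finset.inter_insert_of_notMem]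
    · rw [laterDegree_cons_of_ne G h]
      simp [peelStep, h]

lemma density_best_le_peelStep (s : State V) (v : V) :
    density G s.best ≤ density G (peelStep G s v).best := by
  simp only [peelStep]
  split_ifs with h
  · exact h.le
  · exact le_rfl

lemma density_cur_le_peelStep (s : State V) (v : V) :
    density G s.cur ≤ density G (peelStep G s v).best := by
  simp only [peelStep]
  split_ifs with h
  · exact le_rfl
  · exact not_lt.1 h

lemma density_best_le_foldl (l : List V) (s : State V) :
    density G s.best ≤ density G (l.foldl (peelStep G) s).best := by
  induction l generalizing s with
  | nil => exact le_rfl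
  | cons a l ih => exact (density_best_le_peelStep G s a).trans (ih _)

lemma best_foldl_nonempty (l : List V) {s : State V} (hs : s.best.Nonempty) :
    (l.foldl (peelStep G) s).best.Nonempty := by
  induction l generalizing s with
  | nil => exact hs
  | cons a l ih =>
    refine ih ?_
    simp only [peelStep]
    split_ifs with h
    · rw [Finset.nonempty_iff_ne_empty]
      intro h0
      -- The empty set has density `0`, so it never beats the best set.
      rw [h0] at h
      exact absurd h (by simpa [density] using density_nonneg G s.best)
    · exact hs

/-- The best set found is at least as dense as every subgraph encountered while peeling. -/
lemma density_suffix_le_foldl {l : List V} (hl : l.Nodup) {s : State V} (hs : s.cur = l.toFinset)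
    {l' : List V} (h : l' <:+ l) :
    density G l'.toFinset ≤ density G (l.foldl (peelStep G) s).best := by
  induction l generalizing s with
  | nil =>
    obtain rfl := List.suffix_nil.1 h
    simpa [density] using density_nonneg G s.best
  | cons a l ih =>
    rw [List.nodup_cons] at hl
    rcases List.suffix_cons_iff.1 h with rfl | h
    · rw [← hs]
      exact (density_cur_le_peelStep G s a).trans (density_best_le_foldl G l _)
    · have hal : a ∉ l.toFinset := by simpa using hl.1
      exact ih hl.2 (by simp [peelStep, hs, Finset.erase_insert hal]) h

/-! ### The potential -/

lemma exp_mul_natCast_le {η : ℝ} (hη : 0 ≤ η) {d Δ : ℕ} (hd : d ≤ Δ) (hΔ : η * Δ ≤ 1) :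
    Real.exp (η * d) ≤ 1 + η * (1 + η * Δ) * d := by
  have hdΔ : (d : ℝ) ≤ Δ := by exact_mod_cast hd
  have h0 : 0 ≤ η * d := by positivity
  have h1 : η * d ≤ η * Δ := by gcongr
  have h := (abs_le.1 (Real.abs_exp_sub_one_sub_id_le
    (abs_le.2 ⟨by linarith, h1.trans hΔ⟩))).2
  have h2 : η * d * (η * d) ≤ η * d * (η * Δ) := by gcongr
  nlinarith

/-- Growth of the exponential potential in one iteration, if `ρ` bounds the densities of all
suffixes of the peeling order. -/
lemma sum_exp_mul_add_le {l : List V} {f : V → ℕ} (hl : IsSortedByLoad f l) {η ρ : ℝ}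
    (hη : 0 ≤ η) (hΔ : η * G.maxDegree ≤ 1)
    (hρ : ∀ l', l' <:+ l → (density G l'.toFinset : ℝ) ≤ ρ) :
    ∑ v, Real.exp (η * ((f v + laterDegree G l v : ℕ) : ℝ))
      ≤ Real.exp (η * (1 + η * G.maxDegree) * ρ) * ∑ v, Real.exp (η * f v) := by
  obtain ⟨hnd, hmem, hsort⟩ := hl
  have key := sum_mul_laterDegree_le G hnd hmem (w := fun v => Real.exp (η * f v))
    (fun v => (Real.exp_pos _).le)
    (hsort.imp fun {u v} h => Real.exp_le_exp.2 (by gcongr)) hρ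
  calc ∑ v, Real.exp (η * ((f v + laterDegree G l v : ℕ) : ℝ))
      ≤ ∑ v, (Real.exp (η * f v)
          + η * (1 + η * G.maxDegree) * (Real.exp (η * f v) * laterDegree G l v)) := by
        refine Finset.sum_le_sum fun v _ => ?_
        have h := mul_le_mul_of_nonneg_left
          (exp_mul_natCast_le hη (laterDegree_le_maxDegree G l v) hΔ)
          (Real.exp_pos (η * f v)).le
        rw [Nat.cast_add, mul_add, Real.exp_add]
        linarith
    _ = ∑ v, Real.exp (η * f v)
          + η * (1 + η * G.maxDegree) * ∑ v, Real.exp (η * f v) * laterDegree G l v := by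
        rw [Finset.sum_add_distrib, Finset.mul_sum]
    _ ≤ ∑ v, Real.exp (η * f v)
          + η * (1 + η * G.maxDegree) * (ρ * ∑ v, Real.exp (η * f v)) := by gcongr
    _ = (η * (1 + η * G.maxDegree) * ρ + 1) * ∑ v, Real.exp (η * f v) := by ring
    _ ≤ _ := by
        gcongr
        exact Real.add_one_le_exp _

/-! ### Runs of the algorithm -/

variable {G}

lemma IsSortedByLoad.toFinset_eq_univ {f : V → ℕ} {l : List V} (h : IsSortedByLoad f l) :
    l.toFinset = Finset.univ := by
  ext v
  simp [h.2.1 v]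

lemma IsSortedByLoad.load_iteration {s : State V} {l : List V} (h : IsSortedByLoad s.load l)
    (v : V) : (iteration G s l).load v = s.load v + laterDegree G l v :=
  load_foldl_peelStep G h.1 (s := { s with cur := Finset.univ }) h.toFinset_eq_univ.symm v

lemma GreedySortingRun.best_nonempty [Nonempty V] {T : ℕ} {s : State V}
    (h : GreedySortingRun G T s) : s.best.Nonempty := by
  induction h with
  | init => exact Finset.univ_nonempty
  | iter l _ _ ih => exact best_foldl_nonempty G l ih

lemma GreedySortingRun.mul_card_inducedEdges_le {T : ℕ} {s : State V}
    (h : GreedySortingRun G T s) (S : Finset V) :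
    T * (inducedEdges G S).card ≤ ∑ v ∈ S, s.load v := by
  induction h with
  | init => simp
  | iter l _ hl ih =>
    simp only [hl.load_iteration, Finset.sum_add_distrib, add_mul, one_mul]
    exact add_le_add ih (card_inducedEdges_le_sum_laterDegree G hl.1
      (hl.toFinset_eq_univ ▸ Finset.subset_univ S))

/-- The density of the best set found only grows, so the final one bounds the growth of the
potential in every iteration. -/
lemma GreedySortingRun.sum_exp_load_le {T : ℕ} {s : State V} (h : GreedySortingRun G T s)
    {η : ℝ} (hη : 0 ≤ η) (hΔ : η * G.maxDegree ≤ 1) :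
    ∑ v, Real.exp (η * s.load v)
      ≤ Fintype.card V * Real.exp (T * (η * (1 + η * G.maxDegree) * (density G s.best : ℝ))) := by
  induction h with
  | init => simp [initState]
  | @iter t s l _ hl ih =>
    have hmono : (density G s.best : ℝ) ≤ density G (iteration G s l).best := by
      exact_mod_cast density_best_le_foldl G l { s with cur := Finset.univ }
    have hsuff : ∀ l', l' <:+ l →
        (density G l'.toFinset : ℝ) ≤ density G (iteration G s l).best := by
      intro l' h'
      exact_mod_cast density_suffix_le_foldl G hl.1 (s := { s with cur := Finset.univ })
        hl.toFinset_eq_univ.symm h'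
    simp only [hl.load_iteration]
    refine (sum_exp_mul_add_le G hl hη hΔ hsuff).trans ?_
    set ρ : ℝ := ((density G (iteration G s l).best : ℚ) : ℝ)
    calc Real.exp (η * (1 + η * G.maxDegree) * ρ) * ∑ v, Real.exp (η * s.load v)
        ≤ Real.exp (η * (1 + η * G.maxDegree) * ρ)
          * (Fintype.card V * Real.exp (t * (η * (1 + η * G.maxDegree) * ρ))) := by
          gcongr
          refine ih.trans ?_
          gcongr
      _ = _ := by
          rw [mul_left_comm, ← Real.exp_add]
          push_cast
          ring_nf

lemma GreedySortingRun.mul_maxDensity_le [Nonempty V] {T : ℕ} {s : State V}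
    (h : GreedySortingRun G T s) {η : ℝ} (hη : 0 ≤ η) (hΔ : η * G.maxDegree ≤ 1) :
    η * (T * (maxDensity G : ℝ)) ≤ Real.log (Fintype.card V)
      + T * (η * (1 + η * G.maxDegree) * (density G s.best : ℝ)) := by
  obtain ⟨S, hS, hmax⟩ := exists_density_eq_maxDensity G
  obtain ⟨v, -, hv⟩ : ∃ v ∈ S, (T : ℝ) * (maxDensity G : ℝ) ≤ s.load v := by
    refine Finset.exists_le_of_sum_le hS ?_
    have h1 : (T : ℝ) * (inducedEdges G S).card ≤ ∑ v ∈ S, (s.load v : ℝ) := by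
      exact_mod_cast h.mul_card_inducedEdges_le S
    rw [card_inducedEdges_eq, hmax] at h1
    rw [Finset.sum_const, nsmul_eq_mul]
    linarith
  have hn : (0 : ℝ) < Fintype.card V := by exact_mod_cast Fintype.card_pos
  have hexp : Real.exp (η * (T * (maxDensity G : ℝ))) ≤ Fintype.card V
      * Real.exp (T * (η * (1 + η * G.maxDegree) * (density G s.best : ℝ))) :=
    calc Real.exp (η * (T * (maxDensity G : ℝ))) ≤ Real.exp (η * s.load v) := by gcongr
      _ ≤ ∑ u, Real.exp (η * s.load u) :=
        Finset.single_le_sum (f := fun u => Real.exp (η * s.load u))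
          (fun u _ => (Real.exp_pos _).le) (Finset.mem_univ v)
      _ ≤ _ := h.sum_exp_load_le hη hΔ
  rw [← Real.exp_log hn, ← Real.exp_add] at hexp
  exact Real.exp_le_exp.1 hexp

/-- A graph of positive maximum density has an edge. -/
lemma maxDegree_pos_of_maxDensity_pos [Nonempty V] (h : 0 < maxDensity G) : 0 < G.maxDegree := by
  obtain ⟨S, -, hmax⟩ := exists_density_eq_maxDensity G
  have hne : (inducedEdges G S).card ≠ 0 := by
    intro h0
    rw [← hmax, density, h0] at h
    simp at h
  obtain ⟨e, he⟩ := Finset.card_ne_zero.1 hne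
  have he' := (Finset.mem_filter.1 he).1
  induction e with
  | h a b =>
    rw [SimpleGraph.mem_edgeFinset, SimpleGraph.mem_edgeSet] at he'
    exact ((G.degree_pos_iff_exists_adj a).2 ⟨b, he'⟩).trans_le (G.degree_le_maxDegree a)

end DensestSubgraph

theorem mainTheorem1 :
    ∃ C : ℝ, 0 < C ∧
      ∀ (V : Type*) [Fintype V] [DecidableEq V] [Nonempty V]
        (G : SimpleGraph V) [DecidableRel G.Adj] (ε : ℝ) (T : ℕ) (s : DensestSubgraph.State V),
        0 < ε → ε < 1 →
        C * ((G.maxDegree : ℝ) * Real.log (Fintype.card V)) ≤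
          (T : ℝ) * ((DensestSubgraph.maxDensity G : ℝ) * ε ^ 2) →
        DensestSubgraph.GreedySortingRun G T s →
        DensestSubgraph.IsApproxDensest G ε s.best := by
  refine ⟨16, by norm_num, ?_⟩
  intro V _ _ _ G _ ε T s hε0 hε1 hT hrun
  refine ⟨hrun.best_nonempty, ?_⟩
  have hρ0 : (0 : ℝ) ≤ DensestSubgraph.density G s.best := by
    exact_mod_cast DensestSubgraph.density_nonneg G s.best
  rcases le_or_gt (DensestSubgraph.maxDensity G) 0 with hmax | hmax
  · have : (DensestSubgraph.maxDensity G : ℝ) ≤ 0 := by exact_mod_cast hmax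
    exact this.trans (by positivity)
  have hΔnat := DensestSubgraph.maxDegree_pos_of_maxDensity_pos hmax
  have hΔ : (0 : ℝ) < G.maxDegree := by exact_mod_cast hΔnat
  have hn : (1 : ℝ) < Fintype.card V := by
    exact_mod_cast Nat.lt_of_le_of_lt hΔnat G.maxDegree_lt_card_verts
  have hlog := Real.log_pos hn
  have hmax' : (0 : ℝ) < DensestSubgraph.maxDensity G := by exact_mod_cast hmax
  -- The hypothesis on `T` rules out `T = 0`, as its left-hand side is positive.
  have hTpos : (0 : ℝ) < T := by
    have h1 : 0 < (T : ℝ) * ((DensestSubgraph.maxDensity G : ℝ) * ε ^ 2) :=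
      lt_of_lt_of_le (by positivity) hT
    exact pos_of_mul_pos_left h1 (by positivity)
  have hηΔ : ε / (4 * G.maxDegree) * G.maxDegree = ε / 4 := by field_simp
  have h := hrun.mul_maxDensity_le (η := ε / (4 * G.maxDegree)) (by positivity)
    (by rw [hηΔ]; linarith)
  rw [hηΔ] at h
  set M : ℝ := ((DensestSubgraph.maxDensity G : ℚ) : ℝ)
  set ρ : ℝ := ((DensestSubgraph.density G s.best : ℚ) : ℝ)
  set D : ℝ := ((G.maxDegree : ℕ) : ℝ)
  set L : ℝ := Real.log (Fintype.card V)
  -- Multiplying by `4 * D / ε` and bounding the logarithm by the hypothesis on `T` leaves an error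
  -- term of `ε / 4` times the optimum.
  have h1 : ε * (T * M) ≤ 4 * (D * L) + T * (ε * (1 + ε / 4) * ρ) := by
    have h2 := mul_le_mul_of_nonneg_left h (show 0 ≤ 4 * D by positivity)
    have e1 : 4 * D * (ε / (4 * D) * (T * M)) = ε * (T * M) := by field_simp
    have e2 : 4 * D * (L + T * (ε / (4 * D) * (1 + ε / 4) * ρ))
        = 4 * (D * L) + T * (ε * (1 + ε / 4) * ρ) := by field_simp
    rwa [e1, e2] at h2
  have h3 : M * (1 - ε / 4) ≤ (1 + ε / 4) * ρ := by
    have h4 : (ε * T) * (M * (1 - ε / 4)) ≤ (ε * T) * ((1 + ε / 4) * ρ) := by nlinarith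
    exact le_of_mul_le_mul_left h4 (by positivity)
  have h5 : (1 + ε / 4) * ρ ≤ (1 - ε / 4) * ((1 + ε) * ρ) := by
    have : 1 + ε / 4 ≤ (1 - ε / 4) * (1 + ε) := by nlinarith
    rw [← mul_assoc]
    gcongr
  exact le_of_mul_le_mul_left (by linarith : (1 - ε / 4) * M ≤ (1 - ε / 4) * ((1 + ε) * ρ))
    (by linarith)
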